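/- Theorem (cluster graphs $nK_4$). For a finite simple graph $G=(V,E)$ and an injective map $f:V\to\mathbb Z$, let $\sigma(G,f)=\{f(v)+f(w): vw\in E\}$, and let the sum index of $G$ be $S(G)=\min_f|\sigma(G,f)|$, where the minimum is over all injective maps $f:V\to\mathbb Z$. For integers $n\ge 1$, let $nK_4$ denote the disjoint union of $n$ complete graphs on $4$ vertices each. Then, for every integer $n\ge 1$, there is exactly one positive integer $s$ such that $$\binom{\lfloor (s-1)/2\rfloor}{3}+\binom{\lceil (s-1)/2\rceil}{3}<n\le \binom{\lfloor s/2\rfloor}{3}+\binom{\lceil s/2\rceil}{3},$$ and for this $s$ we have $S(nK_4)=s$. (Here $\binom{m}{3}=0$ for $0\le m<3$.) -/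

import Mathlib

/-- The set `σ(G, f)` of rank sums `f v + f w` over the edges `vw` of `G`. -/
def rankSums {V : Type*} (G : SimpleGraph V) (f : V → ℤ) : Set ℤ :=
  {k | ∃ v w, G.Adj v w ∧ f v + f w = k}

/-- A finite graph has only finitely many rank sums, so `Set.ncard` below is their true number. -/
theorem rankSums_finite {V : Type*} [Finite V] (G : SimpleGraph V) (f : V → ℤ) :
    (rankSums G f).Finite := by
  refine (Set.finite_range (fun p : V × V => f p.1 + f p.2)).subset ?_
  rintro k ⟨v, w, -, rfl⟩
  exact ⟨(v, w), rfl⟩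

/-- The sum index `S(G)` of a finite graph: the least number of distinct rank sums, over all
injective assignments of integers to the vertices. -/
noncomputable def sumIndex {V : Type*} [Finite V] (G : SimpleGraph V) : ℕ :=
  sInf {m | ∃ f : V ↪ ℤ, (rankSums G f).ncard = m}

/-- The infimum in the definition of `sumIndex` is a minimum. -/
theorem sumIndex_isLeast {V : Type*} [Finite V] (G : SimpleGraph V) :
    IsLeast {m | ∃ f : V ↪ ℤ, (rankSums G f).ncard = m} (sumIndex G) := by
  have hne : {m | ∃ f : V ↪ ℤ, (rankSums G f).ncard = m}.Nonempty := by
    obtain ⟨n, ⟨e⟩⟩ := Finite.exists_equiv_fin V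
    exact ⟨_, ⟨fun v => ((e v : ℕ) : ℤ), fun v w h => e.injective (Fin.ext (Int.ofNat.inj h))⟩,
      rfl⟩
  exact ⟨Nat.sInf_mem hne, fun m hm => Nat.sInf_le hm⟩

/-- The cluster graph `nK_k`, the disjoint union of `n` complete graphs on `k` vertices each:
`(i, a)` is the vertex `a` of the `i`-th complete graph. -/
def clusterGraph (n k : ℕ) : SimpleGraph (Fin n × Fin k) where
  Adj x y := x.1 = y.1 ∧ x.2 ≠ y.2
  symm := ⟨fun _ _ h => ⟨h.1.symm, h.2.symm⟩⟩
  loopless := ⟨fun _ h => h.2 rfl⟩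

/-! With `s` rank sums one can label `n` disjoint copies of `K₄` exactly when `n ≤ halfTriples s`;
the theorem follows by monotonicity.

Upper limit on `n` (`card_le_halfTriples`): split the sums into a lower and an upper half. In a `K₄`
labelled `a < b < c < d`, the sum `b + c` is the largest of the triangle `abc` and the smallest of
`bcd`, so one of these triangles has all three sums in one half. Three sums determine the labels of
a triangle, so distinct copies use distinct triples.

Construction (`sumIndex_le_of_le_halfTriples`): to three weights assign the four vertices `±x ± y ±
z` with a fixed product of signs. Any two agree in exactly one sign, so they add up to plus or minus
twice a weight. Powers of 3 as weights keep the labels distinct; for odd `s` a weight 0 supplies the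
extra sum 0. -/

/-- The largest number of disjoint `K₄`'s that `s` rank sums can serve. -/
def halfTriples (s : ℕ) : ℕ := (s / 2).choose 3 + ((s + 1) / 2).choose 3

theorem halfTriples_mono : Monotone halfTriples := fun a b h =>
  Nat.add_le_add (Nat.choose_le_choose 3 (Nat.div_le_div_right h))
    (Nat.choose_le_choose 3 (Nat.div_le_div_right (by lia)))

theorem le_halfTriples (n : ℕ) : n ≤ halfTriples (2 * n + 4) := by
  have h1 : (2 * n + 4) / 2 = n + 2 := by lia
  have h2 : n ≤ (n + 2).choose 3 := by
    induction n with
    | zero => simp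
    | succ k ih =>
      have h3 : (k + 2 + 1).choose 3 = (k + 2).choose 2 + (k + 2).choose 3 := rfl
      have h4 : 0 < (k + 2).choose 2 := Nat.choose_pos (by lia)
      have h5 := ih (by lia)
      have h6 : k + 1 + 2 = k + 2 + 1 := by lia
      rw [h6, h3]
      lia
  unfold halfTriples
  rw [h1]
  lia

theorem natCeil_cast_div_two (s : ℕ) : ⌈(s : ℚ) / 2⌉₊ = (s + 1) / 2 := by
  apply le_antisymm
  · rw [Nat.ceil_le, div_le_iff₀ two_pos]
    have : s ≤ (s + 1) / 2 * 2 := by lia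
    exact_mod_cast this
  · rw [Nat.div_le_iff_le_mul_add_pred two_pos]
    have h : (s : ℚ) / 2 ≤ (⌈(s : ℚ) / 2⌉₊ : ℕ) := Nat.le_ceil _
    rw [div_le_iff₀ two_pos] at h
    have : s ≤ ⌈(s : ℚ) / 2⌉₊ * 2 := by exact_mod_cast h
    lia

theorem natFloor_cast_div_two (s : ℕ) : ⌊(s : ℚ) / 2⌋₊ = s / 2 := by
  have := Nat.floor_div_natCast (s : ℚ) 2
  simpa using this

theorem choose_floor_add_choose_ceil (s : ℕ) :
    (⌊(s : ℚ) / 2⌋₊).choose 3 + (⌈(s : ℚ) / 2⌉₊).choose 3 = halfTriples s := by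
  rw [natCeil_cast_div_two, natFloor_cast_div_two, halfTriples]

/-! ### The lower bound -/

theorem exists_initial_subset {α : Type*} [LinearOrder α] (S : Finset α) (k : ℕ)
    (hk : k ≤ S.card) : ∃ L ⊆ S, L.card = k ∧ ∀ x ∈ L, ∀ y ∈ S \ L, x < y := by
  induction k with
  | zero => exact ⟨∅, by simp⟩
  | succ k ih =>
    obtain ⟨L, hLS, hLk, hL⟩ := ih (by lia)
    have hne : (S \ L).Nonempty := by
      rw [← Finset.card_pos, Finset.card_sdiff_of_subset hLS]
      lia
    have hmem := Finset.min'_mem _ hne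
    rw [Finset.mem_sdiff] at hmem
    refine ⟨insert ((S \ L).min' hne) L, Finset.insert_subset hmem.1 hLS,
      by rw [Finset.card_insert_of_notMem hmem.2, hLk], ?_⟩
    intro x hx y hy
    simp only [Finset.mem_sdiff, Finset.mem_insert, not_or] at hx hy
    have hy' : y ∈ S \ L := Finset.mem_sdiff.2 ⟨hy.1, hy.2.2⟩
    rcases hx with rfl | hx
    · exact lt_of_le_of_ne (Finset.min'_le _ _ hy') (Ne.symm hy.2.1)
    · exact hL x hx y hy'

theorem eq_of_triple_eq {α : Type*} [LinearOrder α] {x y z x' y' z' : α}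
    (h1 : x < y) (h2 : y < z) (h1' : x' < y') (h2' : y' < z')
    (h : ({x, y, z} : Finset α) = {x', y', z'}) : x = x' ∧ y = y' ∧ z = z' := by
  have hx : x ∈ ({x', y', z'} : Finset α) := h ▸ by simp
  have hy : y ∈ ({x', y', z'} : Finset α) := h ▸ by simp
  have hz : z ∈ ({x', y', z'} : Finset α) := h ▸ by simp
  have hx' : x' ∈ ({x, y, z} : Finset α) := h ▸ by simp
  have hy' : y' ∈ ({x, y, z} : Finset α) := h ▸ by simp
  have hz' : z' ∈ ({x, y, z} : Finset α) := h ▸ by simp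
  simp only [Finset.mem_insert, Finset.mem_singleton] at hx hy hz hx' hy' hz'
  grind

/-- The rank sums of a triangle with vertices labelled `p`, `q`, `r`. -/
def triangleSums (p q r : ℤ) : Finset ℤ := {p + q, p + r, q + r}

theorem card_triangleSums {p q r : ℤ} (h1 : p < q) (h2 : q < r) :
    (triangleSums p q r).card = 3 :=
  Finset.card_eq_three.2 ⟨_, _, _, by lia, by lia, by lia, rfl⟩

/-- The sorted sums are `p + q < p + r < q + r`, and `2q = (p + q) + (q + r) - (p + r)`. One common
label is enough to identify two copies of `K₄`. -/
theorem triangleSums_inj {p q r p' q' r' : ℤ} (h1 : p < q) (h2 : q < r) (h1' : p' < q')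
    (h2' : q' < r') (h : triangleSums p q r = triangleSums p' q' r') : q = q' := by
  obtain ⟨_, _, _⟩ := eq_of_triple_eq (by lia) (by lia) (by lia) (by lia) h
  lia

theorem card_le_halfTriples {n : ℕ} (S : Finset ℤ) (e : Fin n → Fin 4 → ℤ)
    (he : ∀ i, StrictMono (e i)) (hS : ∀ i a b, a ≠ b → e i a + e i b ∈ S)
    (hdisj : ∀ i j a b, e i a = e j b → i = j) : n ≤ halfTriples S.card := by
  obtain ⟨L, hLS, hLk, hL⟩ := exists_initial_subset S (S.card / 2) (Nat.div_le_self _ _)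
  have hcard : (Finset.powersetCard 3 L ∪ Finset.powersetCard 3 (S \ L)).card
      ≤ halfTriples S.card := by
    refine (Finset.card_union_le _ _).trans ?_
    rw [Finset.card_powersetCard, Finset.card_powersetCard, Finset.card_sdiff_of_subset hLS, hLk,
      halfTriples, show S.card - S.card / 2 = (S.card + 1) / 2 by lia]
  refine le_trans ?_ hcard
  have h01 (i) : e i 0 < e i 1 := he i (by decide)
  have h12 (i) : e i 1 < e i 2 := he i (by decide)
  have h23 (i) : e i 2 < e i 3 := he i (by decide)
  have hmem (x y : ℤ) (hx : x ∈ S) (hy : y ∈ L) (hxy : x ≤ y) : x ∈ L := by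
    by_contra hxL
    exact absurd (hL y hy x (Finset.mem_sdiff.2 ⟨hx, hxL⟩)) (not_lt.2 hxy)
  let φ : Fin n → Finset ℤ := fun i =>
    if e i 1 + e i 2 ∈ L then triangleSums (e i 0) (e i 1) (e i 2)
    else triangleSums (e i 1) (e i 2) (e i 3)
  have hφ : Set.MapsTo φ (Finset.univ : Finset (Fin n))
      (Finset.powersetCard 3 L ∪ Finset.powersetCard 3 (S \ L) : Finset (Finset ℤ)) := by
    intro i _
    rw [Finset.mem_coe, Finset.mem_union, Finset.mem_powersetCard, Finset.mem_powersetCard]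
    by_cases h : e i 1 + e i 2 ∈ L
    · left
      simp only [φ, if_pos h, card_triangleSums (h01 i) (h12 i), and_true]
      intro x hx
      simp only [triangleSums, Finset.mem_insert, Finset.mem_singleton] at hx
      have := h01 i
      have := h12 i
      rcases hx with rfl | rfl | rfl
      · exact hmem _ _ (hS i _ _ (by decide)) h (by lia)
      · exact hmem _ _ (hS i _ _ (by decide)) h (by lia)
      · exact h
    · right
      simp only [φ, if_neg h, card_triangleSums (h12 i) (h23 i), and_true]
      intro x hx
      simp only [triangleSums, Finset.mem_insert, Finset.mem_singleton] at hx
      have := h12 i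
      have := h23 i
      have h0 := hS i 1 2 (by decide)
      rw [Finset.mem_sdiff]
      rcases hx with rfl | rfl | rfl
      · exact ⟨h0, h⟩
      · exact ⟨hS i _ _ (by decide), fun hL => h (hmem _ _ h0 hL (by lia))⟩
      · exact ⟨hS i _ _ (by decide), fun hL => h (hmem _ _ h0 hL (by lia))⟩
  have hinj : Set.InjOn φ (Finset.univ : Finset (Fin n)) := by
    intro i _ j _ hij
    simp only [φ] at hij
    split_ifs at hij
    · exact hdisj _ _ _ _ (triangleSums_inj (h01 i) (h12 i) (h01 j) (h12 j) hij)
    · exact hdisj _ _ _ _ (triangleSums_inj (h01 i) (h12 i) (h12 j) (h23 j) hij)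
    · exact hdisj _ _ _ _ (triangleSums_inj (h12 i) (h23 i) (h01 j) (h12 j) hij)
    · exact hdisj _ _ _ _ (triangleSums_inj (h12 i) (h23 i) (h12 j) (h23 j) hij)
  simpa using Finset.card_le_card_of_injOn φ hφ hinj

theorem le_halfTriples_ncard {n : ℕ} (f : Fin n × Fin 4 ↪ ℤ) :
    n ≤ halfTriples (rankSums (clusterGraph n 4) f).ncard := by
  have hfin := rankSums_finite (clusterGraph n 4) f
  let V : Fin n → Finset ℤ := fun i => Finset.univ.image fun a => f (i, a)
  have hV (i) : (V i).card = 4 := by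
    rw [Finset.card_image_of_injective, Finset.card_univ, Fintype.card_fin]
    intro a b h
    simpa using f.injective h
  have hmem (i a) : ∃ b, f (i, b) = (V i).orderEmbOfFin (hV i) a := by
    obtain ⟨b, -, hb⟩ := Finset.mem_image.1 ((V i).orderEmbOfFin_mem (hV i) a)
    exact ⟨b, hb⟩
  rw [Set.ncard_eq_toFinset_card _ hfin]
  refine card_le_halfTriples _ (fun i => (V i).orderEmbOfFin (hV i))
    (fun i => OrderEmbedding.strictMono _) ?_ ?_
  · intro i a b hab
    obtain ⟨a', ha⟩ := hmem i a
    obtain ⟨b', hb⟩ := hmem i b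
    rw [hfin.mem_toFinset, ← ha, ← hb]
    refine ⟨(i, a'), (i, b'), ⟨rfl, ?_⟩, rfl⟩
    rintro (rfl : a' = b')
    exact hab (((V i).orderEmbOfFin (hV i)).injective (ha.symm.trans hb))
  · intro i j a b hab
    obtain ⟨a', ha⟩ := hmem i a
    obtain ⟨b', hb⟩ := hmem j b
    exact congrArg Prod.fst (f.injective (ha.trans (hab.trans hb.symm)))

/-! ### The construction -/

/-- The residue mod 3 fixes the lowest digit; induct on the rest. -/
theorem balanced_ternary_unique (m : ℕ) (c d : ℕ → ℤ) (hc : ∀ i, |c i| ≤ 1) (hd : ∀ i, |d i| ≤ 1)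
    (h : ∑ i ∈ Finset.range m, c i * 3 ^ i = ∑ i ∈ Finset.range m, d i * 3 ^ i) :
    ∀ i < m, c i = d i := by
  induction m generalizing c d with
  | zero => intro i hi; lia
  | succ m ih =>
    have key (c : ℕ → ℤ) : ∑ i ∈ Finset.range (m + 1), c i * 3 ^ i
        = 3 * (∑ i ∈ Finset.range m, c (i + 1) * 3 ^ i) + c 0 := by
      rw [Finset.sum_range_succ', Finset.mul_sum]
      simp only [pow_zero, mul_one, pow_succ]
      congr 1
      exact Finset.sum_congr rfl fun _ _ => by ring
    rw [key, key] at h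
    have h1 := abs_le.1 (hc 0)
    have h2 := abs_le.1 (hd 0)
    intro i hi
    rcases i with _ | i
    · lia
    · exact ih (fun i => c (i + 1)) (fun i => d (i + 1)) (fun i => hc _) (fun i => hd _) (by lia)
        i (by lia)

/-- The four sign patterns on three coordinates whose product of signs is positive. -/
def evenSign : Fin 4 → Fin 3 → ℤ :=
  ![![1, 1, 1], ![1, -1, -1], ![-1, 1, -1], ![-1, -1, 1]]

/-- The sign of a `Bool`. -/
def boolSign (σ : Bool) : ℤ := if σ then 1 else -1

/-- The coefficient at `i` of the vertex with signs `boolSign σ * evenSign a` on the triple `t`. -/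
def vertexCoeff (t : Fin 3 → ℕ) (σ : Bool) (a : Fin 4) (i : ℕ) : ℤ :=
  ∑ l, if t l = i then boolSign σ * evenSign a l else 0

/-- The weights `3 ^ i` for `i < m`, and `0` from `m` on. -/
def ternaryWeight (m i : ℕ) : ℤ := if i < m then 3 ^ i else 0

/-- The label of a vertex of the construction. -/
def vertexLabel (m : ℕ) (t : Fin 3 → ℕ) (σ : Bool) (a : Fin 4) : ℤ :=
  ∑ l, boolSign σ * evenSign a l * ternaryWeight m (t l)

theorem vertexLabel_eq (m : ℕ) (t : Fin 3 → ℕ) (σ : Bool) (a : Fin 4) :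
    vertexLabel m t σ a = ∑ i ∈ Finset.range m, vertexCoeff t σ a i * 3 ^ i := by
  simp only [vertexLabel, vertexCoeff, Finset.sum_mul]
  rw [Finset.sum_comm]
  refine Finset.sum_congr rfl fun l _ => ?_
  simp [ternaryWeight, ite_mul]

theorem vertexCoeff_apply {t : Fin 3 → ℕ} (ht : Function.Injective t) (σ : Bool) (a : Fin 4)
    (l : Fin 3) : vertexCoeff t σ a (t l) = boolSign σ * evenSign a l := by
  simp [vertexCoeff, ht.eq_iff]

theorem vertexCoeff_of_notMem {t : Fin 3 → ℕ} (σ : Bool) (a : Fin 4) {i : ℕ}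
    (hi : i ∉ Set.range t) : vertexCoeff t σ a i = 0 :=
  Finset.sum_eq_zero fun l _ => if_neg fun h => hi ⟨l, h⟩

theorem abs_sign (σ : Bool) (a : Fin 4) (l : Fin 3) : |boolSign σ * evenSign a l| = 1 := by
  revert σ a l
  decide

theorem abs_vertexCoeff_le {t : Fin 3 → ℕ} (ht : Function.Injective t) (σ : Bool) (a : Fin 4)
    (i : ℕ) : |vertexCoeff t σ a i| ≤ 1 := by
  by_cases hi : i ∈ Set.range t
  · obtain ⟨l, rfl⟩ := hi
    rw [vertexCoeff_apply ht, abs_sign]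
  · simp [vertexCoeff_of_notMem σ a hi]

theorem vertexCoeff_ne_zero_iff {t : Fin 3 → ℕ} (ht : Function.Injective t) (σ : Bool)
    (a : Fin 4) (i : ℕ) : vertexCoeff t σ a i ≠ 0 ↔ i ∈ Set.range t := by
  refine ⟨fun h => by_contra fun hi => h (vertexCoeff_of_notMem σ a hi), ?_⟩
  rintro ⟨l, rfl⟩ h
  have := abs_sign σ a l
  rw [← vertexCoeff_apply ht, h] at this
  simp at this

/-- The product of the three signs is `boolSign σ`. -/
theorem sign_eq_of_three {σ σ' : Bool} {a a' : Fin 4}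
    (h : ∀ l, boolSign σ * evenSign a l = boolSign σ' * evenSign a' l) : σ = σ' ∧ a = a' := by
  revert σ σ' a a'
  decide

/-- With `σ` known, the product of the signs forces the third one. -/
theorem sign_eq_of_two {σ : Bool} {a a' : Fin 4}
    (h0 : boolSign σ * evenSign a 0 = boolSign σ * evenSign a' 0)
    (h1 : boolSign σ * evenSign a 1 = boolSign σ * evenSign a' 1) : a = a' := by
  revert σ a a'
  decide

theorem eq_of_inter_range_eq {m : ℕ} {t t' : Finset ℕ} (ht : t ⊆ Finset.range (m + 1))
    (ht' : t' ⊆ Finset.range (m + 1)) (hcard : t.card = t'.card)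
    (h : ∀ i < m, i ∈ t ↔ i ∈ t') : t = t' := by
  have he : t.erase m = t'.erase m := by
    ext i
    simp only [Finset.mem_erase]
    refine and_congr_right fun him => ⟨fun hi => ?_, fun hi => ?_⟩
    · have := Finset.mem_range.1 (ht hi)
      exact (h i (by lia)).1 hi
    · have := Finset.mem_range.1 (ht' hi)
      exact (h i (by lia)).2 hi
  have hc := congrArg Finset.card he
  by_cases hm : m ∈ t <;> by_cases hm' : m ∈ t'
  · rw [← Finset.insert_erase hm, ← Finset.insert_erase hm', he]
  · rw [Finset.card_erase_of_mem hm, Finset.erase_eq_of_notMem hm'] at hc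
    have := Finset.card_pos.2 ⟨m, hm⟩
    lia
  · rw [Finset.card_erase_of_mem hm', Finset.erase_eq_of_notMem hm] at hc
    have := Finset.card_pos.2 ⟨m, hm'⟩
    lia
  · rwa [Finset.erase_eq_of_notMem hm, Finset.erase_eq_of_notMem hm'] at he

/-- Index `m` has weight 0 and leaves no digit in the label. Its membership in `t` is recovered from
`t.card = 3`. Its sign is lost, so both values of `σ` would give the same labels; hence `hσ` allows
only `true` there. -/
theorem vertexLabel_injective {m : ℕ} {t t' : Finset ℕ} (hc : t.card = 3) (hc' : t'.card = 3)
    {σ σ' : Bool} (ht : t ⊆ Finset.range (m + 1)) (ht' : t' ⊆ Finset.range (m + 1))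
    (hσ : σ = false → m ∉ t) (hσ' : σ' = false → m ∉ t') {a a' : Fin 4}
    (h : vertexLabel m (t.orderEmbOfFin hc) σ a = vertexLabel m (t'.orderEmbOfFin hc') σ' a') :
    t = t' ∧ σ = σ' ∧ a = a' := by
  have hi := (t.orderEmbOfFin hc).injective
  have hi' := (t'.orderEmbOfFin hc').injective
  rw [vertexLabel_eq, vertexLabel_eq] at h
  have hcoeff := balanced_ternary_unique m _ _ (abs_vertexCoeff_le hi σ a)
    (abs_vertexCoeff_le hi' σ' a') h
  have htt : t = t' := by
    refine eq_of_inter_range_eq ht ht' (hc.trans hc'.symm) fun i him => ?_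
    have h1 := vertexCoeff_ne_zero_iff hi σ a i
    have h2 := vertexCoeff_ne_zero_iff hi' σ' a' i
    rw [Finset.range_orderEmbOfFin, Finset.mem_coe] at h1 h2
    rw [← h1, ← h2, hcoeff i him]
  subst htt
  have hl (l : Fin 3) (hlm : t.orderEmbOfFin hc l < m) :
      boolSign σ * evenSign a l = boolSign σ' * evenSign a' l := by
    rw [← vertexCoeff_apply hi, ← vertexCoeff_apply hi, hcoeff _ hlm]
  have hle (l : Fin 3) : t.orderEmbOfFin hc l ≤ m :=
    Nat.lt_succ_iff.1 (Finset.mem_range.1 (ht (t.orderEmbOfFin_mem hc l)))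
  refine ⟨rfl, ?_⟩
  by_cases hm : m ∈ t
  · have hs : σ = true := by
      by_contra hf
      exact hσ (by simpa using hf) hm
    have hs' : σ' = true := by
      by_contra hf
      exact hσ' (by simpa using hf) hm
    subst hs hs'
    -- Only the last, largest position can hold `m`, so the first two signs are visible.
    have h02 : t.orderEmbOfFin hc 0 < t.orderEmbOfFin hc 2 :=
      (t.orderEmbOfFin hc).strictMono (by decide)
    have h12 : t.orderEmbOfFin hc 1 < t.orderEmbOfFin hc 2 :=
      (t.orderEmbOfFin hc).strictMono (by decide)
    exact ⟨rfl, sign_eq_of_two (hl 0 (h02.trans_le (hle 2))) (hl 1 (h12.trans_le (hle 2)))⟩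
  · exact sign_eq_of_three fun l => hl l ((hle l).lt_of_ne fun h =>
      hm (h ▸ t.orderEmbOfFin_mem hc l))

theorem evenSign_add {a b : Fin 4} (hab : a ≠ b) : ∃ (l : Fin 3) (τ : Bool),
    ∀ k, evenSign a k + evenSign b k = if k = l then 2 * boolSign τ else 0 := by
  revert a b
  decide

theorem vertexLabel_add (m : ℕ) (t : Fin 3 → ℕ) (σ : Bool) {a b : Fin 4} (hab : a ≠ b) :
    ∃ (l : Fin 3) (τ : Bool),
      vertexLabel m t σ a + vertexLabel m t σ b = 2 * boolSign τ * ternaryWeight m (t l) := by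
  obtain ⟨l, τ, hl⟩ := evenSign_add hab
  refine ⟨l, if σ then τ else !τ, ?_⟩
  have hsign : boolSign σ * boolSign τ = boolSign (if σ then τ else !τ) := by
    cases σ <;> cases τ <;> decide
  calc vertexLabel m t σ a + vertexLabel m t σ b
      = ∑ k, boolSign σ * (evenSign a k + evenSign b k) * ternaryWeight m (t k) := by
        rw [vertexLabel, vertexLabel, ← Finset.sum_add_distrib]
        exact Finset.sum_congr rfl fun _ _ => by ring
    _ = 2 * (boolSign σ * boolSign τ) * ternaryWeight m (t l) := by
        simp only [hl, mul_ite, ite_mul, mul_zero, zero_mul, Finset.sum_ite_eq', Finset.mem_univ,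
          if_true]
        ring
    _ = _ := by rw [hsign]

/-- The triples of the construction: those with sign `true` come from `range ((s + 1) / 2)`,
those with sign `false` from `range (s / 2)`. -/
def signedTriples (s : ℕ) : Finset (Finset ℕ ⊕ Finset ℕ) :=
  (Finset.powersetCard 3 (Finset.range (s / 2))).disjSum
    (Finset.powersetCard 3 (Finset.range ((s + 1) / 2)))

theorem card_signedTriples (s : ℕ) : (signedTriples s).card = halfTriples s := by
  simp [signedTriples, halfTriples]

theorem signedTriples_spec {s : ℕ} {x : Finset ℕ ⊕ Finset ℕ} (hx : x ∈ signedTriples s) :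
    (x.elim id id).card = 3 ∧ x.elim id id ⊆ Finset.range ((s + 1) / 2) ∧
      (x.isRight = false → s / 2 ∉ x.elim id id) := by
  have hsub : Finset.range (s / 2) ⊆ Finset.range ((s + 1) / 2) :=
    Finset.range_subset_range.2 (by lia)
  rcases x with t | t
  · simp only [signedTriples, Finset.inl_mem_disjSum, Finset.mem_powersetCard] at hx
    exact ⟨hx.2, hx.1.trans hsub, fun _ h => Finset.notMem_range_self (hx.1 h)⟩
  · simp only [signedTriples, Finset.inr_mem_disjSum, Finset.mem_powersetCard] at hx
    exact ⟨hx.2, hx.1, fun h => by simp at h⟩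

/-- The rank sums available to the construction. -/
def availableSums (s : ℕ) : Finset ℤ :=
  (Finset.range ((s + 1) / 2)).image (fun i => 2 * ternaryWeight (s / 2) i) ∪
    (Finset.range (s / 2)).image (fun i => -(2 * ternaryWeight (s / 2) i))

theorem card_availableSums_le (s : ℕ) : (availableSums s).card ≤ s := by
  refine (Finset.card_union_le _ _).trans ((Nat.add_le_add Finset.card_image_le
    Finset.card_image_le).trans ?_)
  rw [Finset.card_range, Finset.card_range]
  lia

theorem mem_availableSums {s i : ℕ} (hi : i < (s + 1) / 2) (τ : Bool) :
    2 * boolSign τ * ternaryWeight (s / 2) i ∈ availableSums s := by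
  simp only [availableSums, Finset.mem_union, Finset.mem_image, Finset.mem_range]
  by_cases him : i < s / 2
  · cases τ
    · exact Or.inr ⟨i, him, by simp [boolSign]⟩
    · exact Or.inl ⟨i, hi, by simp [boolSign]⟩
  · exact Or.inl ⟨i, hi, by simp [ternaryWeight, him]⟩

theorem sumIndex_le_of_le_halfTriples {n s : ℕ} (h : n ≤ halfTriples s) :
    sumIndex (clusterGraph n 4) ≤ s := by
  rw [← card_signedTriples] at h
  let x : Fin n → signedTriples s := fun i => (signedTriples s).equivFin.symm (Fin.castLE h i)
  have hx : Function.Injective x :=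
    (signedTriples s).equivFin.symm.injective.comp (Fin.castLE_injective h)
  have hspec (i) := signedTriples_spec (x i).2
  let t : Fin n → Fin 3 ↪o ℕ := fun i => ((x i).1.elim id id).orderEmbOfFin (hspec i).1
  have hsub : Finset.range ((s + 1) / 2) ⊆ Finset.range (s / 2 + 1) :=
    Finset.range_subset_range.2 (by lia)
  let f : Fin n × Fin 4 ↪ ℤ :=
    { toFun := fun v => vertexLabel (s / 2) (t v.1) (x v.1).1.isRight v.2
      inj' := by
        rintro ⟨i, a⟩ ⟨j, b⟩ hij
        obtain ⟨h1, h2, h3⟩ := vertexLabel_injective (hspec i).1 (hspec j).1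
          ((hspec i).2.1.trans hsub) ((hspec j).2.1.trans hsub) (hspec i).2.2 (hspec j).2.2 hij
        refine Prod.ext (hx (Subtype.ext ?_)) h3
        generalize (x i).1 = y at h1 h2
        generalize (x j).1 = z at h1 h2
        rcases y with y | y <;> rcases z with z | z <;> simp_all }
  refine ((sumIndex_isLeast (clusterGraph n 4)).2 ⟨f, rfl⟩).trans
    (le_trans ?_ (card_availableSums_le s))
  rw [← Set.ncard_coe_finset]
  refine Set.ncard_le_ncard ?_ (Finset.finite_toSet _)
  rintro k ⟨⟨i, a⟩, ⟨j, b⟩, ⟨hij, hab⟩, rfl⟩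
  obtain rfl : i = j := hij
  obtain ⟨l, τ, hl⟩ := vertexLabel_add (s / 2) (t i) (x i).1.isRight hab
  have hmem := (hspec i).2.1 (Finset.orderEmbOfFin_mem _ (hspec i).1 l)
  rw [Finset.mem_coe]
  exact hl ▸ mem_availableSums (Finset.mem_range.1 hmem) τ

/-! ### Combining the two bounds -/

theorem sumIndex_clusterGraph_four {n r : ℕ} (h1 : halfTriples r < n)
    (h2 : n ≤ halfTriples (r + 1)) : sumIndex (clusterGraph n 4) = r + 1 := by
  refine le_antisymm (sumIndex_le_of_le_halfTriples h2) ?_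
  obtain ⟨f, hf⟩ := (sumIndex_isLeast (clusterGraph n 4)).1
  by_contra hlt
  have h3 := le_halfTriples_ncard f
  rw [hf] at h3
  have h4 := halfTriples_mono (show sumIndex (clusterGraph n 4) ≤ r by lia)
  lia

theorem exists_halfTriples_lt_le {n : ℕ} (hn : 1 ≤ n) :
    ∃ r, halfTriples r < n ∧ n ≤ halfTriples (r + 1) := by
  classical
  have hex : ∃ s, n ≤ halfTriples s := ⟨_, le_halfTriples n⟩
  have h0 : Nat.find hex ≠ 0 := by
    intro h
    have := Nat.find_spec hex
    rw [h] at this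
    simp [halfTriples] at this
    lia
  obtain ⟨r, hr⟩ := Nat.exists_eq_succ_of_ne_zero h0
  have hspec := Nat.find_spec hex
  rw [hr] at hspec
  exact ⟨r, not_le.1 (Nat.find_min hex (by lia)), hspec⟩

theorem mainTheorem3 (n : ℕ) (hn : 1 ≤ n) :
    (∃! s : ℕ, 1 ≤ s ∧
      (⌊((s : ℚ) - 1) / 2⌋₊).choose 3 + (⌈((s : ℚ) - 1) / 2⌉₊).choose 3 < n ∧
      n ≤ (⌊(s : ℚ) / 2⌋₊).choose 3 + (⌈(s : ℚ) / 2⌉₊).choose 3) ∧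
    ∀ s : ℕ, 1 ≤ s →
      (⌊((s : ℚ) - 1) / 2⌋₊).choose 3 + (⌈((s : ℚ) - 1) / 2⌉₊).choose 3 < n →
      n ≤ (⌊(s : ℚ) / 2⌋₊).choose 3 + (⌈(s : ℚ) / 2⌉₊).choose 3 →
      sumIndex (clusterGraph n 4) = s := by
  have hsucc (r : ℕ) : (((r + 1 : ℕ) : ℚ) - 1) = r := by push_cast; ring
  have hindex : ∀ s : ℕ, 1 ≤ s →
      (⌊((s : ℚ) - 1) / 2⌋₊).choose 3 + (⌈((s : ℚ) - 1) / 2⌉₊).choose 3 < n →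
      n ≤ (⌊(s : ℚ) / 2⌋₊).choose 3 + (⌈(s : ℚ) / 2⌉₊).choose 3 →
      sumIndex (clusterGraph n 4) = s := by
    intro s hs h1 h2
    obtain ⟨r, rfl⟩ := Nat.exists_eq_add_of_le' hs
    rw [hsucc, choose_floor_add_choose_ceil] at h1
    rw [choose_floor_add_choose_ceil] at h2
    exact sumIndex_clusterGraph_four h1 h2
  refine ⟨?_, hindex⟩
  obtain ⟨r, h1, h2⟩ := exists_halfTriples_lt_le hn
  rw [← choose_floor_add_choose_ceil] at h1 h2
  rw [← hsucc] at h1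
  -- Uniqueness is free: every admissible `s` equals the sum index.
  exact ⟨r + 1, ⟨by lia, h1, h2⟩, fun s hs =>
    (hindex s hs.1 hs.2.1 hs.2.2).symm.trans (hindex (r + 1) (by lia) h1 h2)⟩
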